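/- Let $\mathbb{F}$ be a field with $\operatorname{char}\mathbb{F}\neq 2$, and let $A$ be a commutative, not necessarily associative, $\mathbb{F}$-algebra. For $a\in A$ and $\mu\in\mathbb{F}$ put $A_\mu(a)=\{x\in A : ax=\mu x\}$. A nonzero idempotent $a\in A$ is an \emph{axis of Jordan type $\frac12$} of $A$ if $A=A_1(a)\oplus A_0(a)\oplus A_{1/2}(a)$ and $$A_1(a)A_1(a)\subseteq A_1(a),\quad A_1(a)A_0(a)=0,\quad A_0(a)A_0(a)\subseteq A_0(a),$$ $$A_1(a)A_{1/2}(a)\subseteq A_{1/2}(a),\quad A_0(a)A_{1/2}(a)\subseteq A_{1/2}(a),\quad A_{1/2}(a)A_{1/2}(a)\subseteq A_0(a)\oplus A_1(a).$$ A nonzero idempotent $c$ of an algebra $B$ is \emph{primitive} in $B$ if $B_1(c)=\mathbb{F}c$. Let $(A,X)$ be a primitive axial algebra of Jordan type $\frac12$; that is, $X\subseteq A$ is a set of axes of Jordan type $\frac12$, each primitive in $A$, which generates $A$ as an algebra. Then there is a unique bilinear form $(\cdot,\cdot)$ on $A$ with $(x,yz)=(xy,z)$ for all $x,y,z\in A$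 and $(a,a)=1$ for all $a\in X$ (the Frobenius form of $A$). For $a,b\in X$ let $\langle\langle a,b\rangle\rangle$ be the subalgebra of $A$ generated by $a$ and $b$. If $(a,b)\neq\frac14$ or $\dim_{\mathbb{F}}\langle\langle a,b\rangle\rangle\neq 3$, then $\langle\langle a,b\rangle\rangle$ is \emph{solid}: every primitive idempotent of the algebra $\langle\langle a,b\rangle\rangle$ is an axis of Jordan type $\frac12$ of $A$. -/

import Mathlib

namespace AxialJordan

variable (F : Type*) [Field F] {A : Type*} [NonUnitalNonAssocCommRing A] [Module F A]
  [SMulCommClass F A A]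

/-- The `μ`-eigenspace `A_μ(a)` of the multiplication operator `ad a : x ↦ a * x`. -/
def adEigenspace (a : A) (μ : F) : Submodule F A :=
  Module.End.eigenspace (LinearMap.mulLeft F a) μ

/-- `a` is an axis of Jordan type `η`: a nonzero idempotent such that `ad a` is semisimple with
spectrum in `{1, 0, η}` and whose eigenspaces multiply according to the Jordan fusion law
`1 ⋆ 1 = {1}`, `1 ⋆ 0 = ∅`, `0 ⋆ 0 = {0}`, `1 ⋆ η = {η}`, `0 ⋆ η = {η}`, `η ⋆ η = {0, 1}`. -/
structure IsJordanAxis (η : F) (a : A) : Prop where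
  ne_zero : a ≠ 0
  idem : a * a = a
  semisimple : adEigenspace F a 1 ⊔ adEigenspace F a 0 ⊔ adEigenspace F a η = ⊤
  one_one : ∀ x ∈ adEigenspace F a 1, ∀ y ∈ adEigenspace F a 1, x * y ∈ adEigenspace F a 1
  one_zero : ∀ x ∈ adEigenspace F a 1, ∀ y ∈ adEigenspace F a 0, x * y = 0
  zero_zero : ∀ x ∈ adEigenspace F a 0, ∀ y ∈ adEigenspace F a 0, x * y ∈ adEigenspace F a 0
  one_eta : ∀ x ∈ adEigenspace F a 1, ∀ y ∈ adEigenspace F a η, x * y ∈ adEigenspace F a η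
  zero_eta : ∀ x ∈ adEigenspace F a 0, ∀ y ∈ adEigenspace F a η, x * y ∈ adEigenspace F a η
  eta_eta : ∀ x ∈ adEigenspace F a η, ∀ y ∈ adEigenspace F a η,
    x * y ∈ adEigenspace F a 0 ⊔ adEigenspace F a 1

/-- A nonzero idempotent `c` of `A` is primitive in `A` if `A_1(c)` is spanned by `c`. -/
structure IsPrimitiveIdempotent (c : A) : Prop where
  ne_zero : c ≠ 0
  idem : c * c = c
  eigenspace_one : adEigenspace F c 1 = Submodule.span F {c}

variable [IsScalarTower F A A]

/-- `(A, X)` is a primitive axial algebra of Jordan type `η`: the set `X` consists of primitive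
axes of Jordan type `η` and generates the algebra `A`. -/
structure IsPrimitiveAxialAlgebra (η : F) (X : Set A) : Prop where
  axis : ∀ a ∈ X, IsJordanAxis F η a
  primitive : ∀ a ∈ X, IsPrimitiveIdempotent F a
  generates : NonUnitalAlgebra.adjoin F X = ⊤

/-- A Frobenius form on `A` (a bilinear form associating with the product), normalised so that
`(a, a) = 1` for the generating axes `a ∈ X`. -/
structure IsFrobeniusForm (X : Set A) (form : LinearMap.BilinForm F A) : Prop where
  assoc : ∀ x y z : A, form x (y * z) = form (x * y) z
  normalised : ∀ a ∈ X, form a a = 1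

/-- The subalgebra `⟨⟨a, b⟩⟩` generated by `a` and `b`. -/
def line (a b : A) : NonUnitalSubalgebra F A := NonUnitalAlgebra.adjoin F {a, b}

/-- A subalgebra `B` of `A` is solid if every primitive idempotent of the algebra `B` (primitivity
being taken inside `B`) is an axis of Jordan type one half of the whole algebra `A`. -/
def IsSolid (B : NonUnitalSubalgebra F A) : Prop :=
  ∀ c : B, IsPrimitiveIdempotent F c → IsJordanAxis F (1 / 2 : F) (c : A)

end AxialJordan

set_option linter.unusedSectionVars false

/-! ### The axis condition as a system of equations -/

namespace AxialJordan

variable {F : Type*} [Field F] {A : Type*} [NonUnitalNonAssocCommRing A] [Module F A]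

/-! For a fixed invariant form, being a primitive axis is a family of polynomial conditions of
degree at most two on the idempotent. It therefore suffices to show that a vector-valued quadratic
function vanishing on all known axes vanishes on the whole curve of primitive idempotents of `⟨⟨a,
b⟩⟩`.

The form comes from the Miyamoto involutions. They permute the primitive axes, and the product of
two axes is a combination of axes, so the axes span `A`. The functionals "coefficient of the
`1`-component" satisfy `φ_a(b) = φ_b(a)`, hence glue to a symmetric form, which is associative
because the involutions preserve it.

Put `α = (a, b)` and `ρ = 2ab - a - b`. Then `ρ` acts on `⟨⟨a, b⟩⟩` as the scalar `α - 1`. In the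
three-dimensional case the primitive idempotents lie on a conic. A quadratic function on a conic is
determined by five points, supplied by `a`, `b` and their images under the two involutions
(`quadratic_eq_zero`). These are five distinct points unless `α = 1/4` (only three, the excluded
case) or `α = 1/2` (only four).

For `α = 1/2` the four points leave one coefficient undetermined, the polarised condition at `v = 2a
- z` and `w = 2b - z`, where `z` is the identity of `⟨⟨a, b⟩⟩`. It vanishes by the Peirce
decomposition of `A` with respect to `z`: on the `1/2`-part, `2v` and `2w` act as anticommuting
involutions, and off it `v` and `w` act through the form alone (`anticomm`, `fusionPart_diff`).

If `ρ = 0` the idempotents form an affine line, where three points suffice; if `ab = 0`, only `a`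
and `b` are primitive. -/

/-- `a` is an idempotent whose Peirce decomposition for the eigenvalues `1, 0, 1/2` is graded and
has `φ x • a` as the `1`-component of `x`. This is an equational form of being a primitive axis of
Jordan type `1/2`. -/
structure PeirceAxis (a : A) (φ : A →ₗ[F] F) : Prop where
  idem : a * a = a
  norm : φ a = 1
  sq : ∀ x, (2 : F) • (a * (a * x)) = a * x + φ x • a
  zero : ∀ x y, a * x = 0 → φ (x * y) = 0
  fusion : ∀ x y, (4 : F) • ((a * x) * (a * y)) =
    x * (a * y) + y * (a * x) - a * (x * y) + φ y • (a * x) + φ x • (a * y) + φ (x * y) • a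

namespace PeirceAxis

variable {a : A} {φ ψ : A →ₗ[F] F}

theorem ne_zero (ha : PeirceAxis a φ) : a ≠ 0 := by
  rintro rfl
  simpa using ha.norm

theorem unique (ha : PeirceAxis a φ) (ha' : PeirceAxis a ψ) : φ = ψ := by
  ext x
  refine smul_left_injective F ha.ne_zero ?_
  have h := (ha.sq x).symm.trans (ha'.sq x)
  exact add_left_cancel h

end PeirceAxis

variable [SMulCommClass F A A]

theorem mem_adEigenspace {a x : A} {μ : F} : x ∈ adEigenspace F a μ ↔ a * x = μ • x := by
  simp [adEigenspace]

theorem IsJordanAxis.exists_decomposition {η : F} {a : A} (ha : IsJordanAxis F η a)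
    (hp : IsPrimitiveIdempotent F a) (x : A) :
    ∃ (l : F) (y z : A), a * y = 0 ∧ a * z = η • z ∧ x = l • a + y + z := by
  have hx : x ∈ adEigenspace F a 1 ⊔ adEigenspace F a 0 ⊔ adEigenspace F a η := by
    rw [ha.semisimple]; trivial
  obtain ⟨u, hu, z, hz, rfl⟩ := Submodule.mem_sup.1 hx
  obtain ⟨w, hw, y, hy, rfl⟩ := Submodule.mem_sup.1 hu
  rw [hp.eigenspace_one] at hw
  obtain ⟨l, rfl⟩ := Submodule.mem_span_singleton.1 hw
  exact ⟨l, y, z, by simpa using mem_adEigenspace.1 hy, mem_adEigenspace.1 hz, rfl⟩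

theorem IsJordanAxis.exists_peirceAxis (h2 : (2 : F) ≠ 0) [IsScalarTower F A A] {a : A}
    (ha : IsJordanAxis F (1 / 2 : F) a) (hp : IsPrimitiveIdempotent F a) :
    ∃ φ : A →ₗ[F] F, PeirceAxis a φ := by
  have inj : Function.Injective fun l : F => l • a := smul_left_injective F ha.ne_zero
  -- The polynomial `2t² - t` vanishes at `0` and `1/2` and equals `1` at `1`, so it projects onto
  -- the `1`-eigenspace, which is `F a` by primitivity.
  have hT : ∀ x, ∃ l : F, (2 : F) • (a * (a * x)) - a * x = l • a := by
    intro x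
    obtain ⟨l, y, z, hy, hz, rfl⟩ := ha.exists_decomposition hp x
    refine ⟨l, ?_⟩
    simp only [mul_add, mul_smul_comm, hy, hz, ha.idem, mul_zero]
    match_scalars <;> field_simp <;> ring
  choose f hf using hT
  let φ : A →ₗ[F] F :=
    { toFun := f
      map_add' := fun x y => inj <| by
        simp only [add_smul, ← hf, mul_add, smul_add]; abel
      map_smul' := fun c x => inj <| by
        simp only [RingHom.id_apply, smul_eq_mul, mul_smul, ← hf, mul_smul_comm, smul_sub]
        module }
  have hφ : ∀ x, (2 : F) • (a * (a * x)) - a * x = φ x • a := hf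
  have eig : ∀ x, ∀ l : F, (2 : F) • (a * (a * x)) - a * x = l • a → φ x = l :=
    fun x l h => inj <| (hφ x).symm.trans h
  have φa : φ a = 1 := eig _ _ <| by rw [ha.idem, ha.idem]; module
  have φ0 : ∀ y, a * y = 0 → φ y = 0 := fun y hy => eig _ _ <| by simp [hy]
  have φh : ∀ z, a * z = (1 / 2 : F) • z → φ z = 0 := fun z hz => eig _ _ <| by
    simp only [hz, mul_smul_comm]
    match_scalars <;> field_simp
    ring
  have f00 : ∀ x y, a * x = 0 → a * y = 0 → a * (x * y) = 0 := fun x y hx hy => by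
    have := ha.zero_zero x (mem_adEigenspace.2 (by simpa using hx)) y
      (mem_adEigenspace.2 (by simpa using hy))
    simpa using mem_adEigenspace.1 this
  have f0h : ∀ x y, a * x = 0 → a * y = (1 / 2 : F) • y → a * (x * y) = (1 / 2 : F) • (x * y) :=
    fun x y hx hy => mem_adEigenspace.1 <| ha.zero_eta x (mem_adEigenspace.2 (by simpa using hx)) y
      (mem_adEigenspace.2 hy)
  have fhh : ∀ x y, a * x = (1 / 2 : F) • x → a * y = (1 / 2 : F) • y →
      a * (x * y) = φ (x * y) • a := fun x y hx hy => by
    have := ha.eta_eta x (mem_adEigenspace.2 hx) y (mem_adEigenspace.2 hy)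
    rw [hp.eigenspace_one] at this
    obtain ⟨u, hu, w, hw, h⟩ := Submodule.mem_sup.1 this
    obtain ⟨l, rfl⟩ := Submodule.mem_span_singleton.1 hw
    have hu : a * u = 0 := by simpa using mem_adEigenspace.1 hu
    rw [← h]
    simp [mul_add, hu, ha.idem, φ0 u hu, φa, mul_smul_comm]
  refine ⟨φ, ha.idem, φa, fun x => by rw [← hφ]; abel, fun x y hx => ?_, fun x y => ?_⟩
  · obtain ⟨m, y0, yh, hy0, hyh, rfl⟩ := ha.exists_decomposition hp y
    simp only [mul_add, mul_smul_comm, mul_comm x a, hx, map_add, map_zero,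
      φh _ (f0h x yh hx hyh), φ0 _ (f00 x y0 hx hy0), smul_zero, add_zero]
  · obtain ⟨l, x0, xh, hx0, hxh, rfl⟩ := ha.exists_decomposition hp x
    obtain ⟨m, y0, yh, hy0, hyh, rfl⟩ := ha.exists_decomposition hp y
    simp only [mul_add, add_mul, smul_mul_assoc, mul_smul_comm, hx0, hxh, hy0, hyh, ha.idem,
      mul_zero, smul_zero, map_add, map_smul, φa, mul_comm x0 a, mul_comm xh a,
      mul_comm y0 a, mul_comm yh a, mul_comm yh xh,
      mul_comm xh y0, smul_add,
      φ0 x0 hx0, φ0 y0 hy0, φh xh hxh, φh yh hyh, φh _ (f0h x0 yh hx0 hyh), φ0 _ (f00 x0 y0 hx0 hy0),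
      φh _ (f0h y0 xh hy0 hxh), f0h x0 yh hx0 hyh, f0h y0 xh hy0 hxh, f00 x0 y0 hx0 hy0,
      fhh xh yh hxh hyh, add_zero, zero_add, smul_eq_mul]
    match_scalars <;> field_simp <;> ring

namespace PeirceAxis

variable {a : A} {φ : A →ₗ[F] F}

theorem apply_mul (ha : PeirceAxis a φ) (x : A) : φ (a * x) = φ x := by
  refine smul_left_injective F ha.ne_zero ?_
  have h1 := ha.sq (a * x)
  have h2 := congrArg (a * ·) (ha.sq x)
  simp only [mul_smul_comm, mul_add, ha.idem] at h1 h2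
  rw [h1] at h2
  exact add_left_cancel h2

theorem isPrimitiveIdempotent (ha : PeirceAxis a φ) :
    IsPrimitiveIdempotent F a where
  ne_zero := ha.ne_zero
  idem := ha.idem
  eigenspace_one := by
    ext x
    rw [mem_adEigenspace, Submodule.mem_span_singleton, one_smul]
    constructor
    · intro h
      have := ha.sq x
      rw [h, h] at this
      exact ⟨φ x, by linear_combination (norm := module) -this⟩
    · rintro ⟨l, rfl⟩
      rw [mul_smul_comm, ha.idem]

theorem isJordanAxis (h2 : (2 : F) ≠ 0) [IsScalarTower F A A] (ha : PeirceAxis a φ) :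
    IsJordanAxis F (1 / 2 : F) a := by
  have one : ∀ x, x ∈ adEigenspace F a 1 → ∃ l : F, l • a = x := fun x hx => by
    rw [ha.isPrimitiveIdempotent.eigenspace_one] at hx
    exact Submodule.mem_span_singleton.1 hx
  have zero : ∀ x, x ∈ adEigenspace F a 0 ↔ a * x = 0 := fun x => by
    rw [mem_adEigenspace, zero_smul]
  have half : ∀ x, x ∈ adEigenspace F a (1 / 2 : F) ↔ (2 : F) • (a * x) = x := fun x => by
    rw [mem_adEigenspace]
    constructor
    · intro h; rw [h, smul_smul]; field_simp; simp
    · intro h; rw [← smul_right_injective A h2 |>.eq_iff]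
      simp only [h, smul_smul]; field_simp; simp
  have φ0 : ∀ x, a * x = 0 → φ x = 0 := fun x hx => by rw [← ha.apply_mul, hx, map_zero]
  have φh : ∀ x, (2 : F) • (a * x) = x → φ x = 0 := fun x hx => by
    have := congrArg φ hx
    rw [map_smul, ha.apply_mul, smul_eq_mul] at this
    linear_combination this
  refine ⟨ha.ne_zero, ha.idem, ?_, ?_, ?_, ?_, ?_, ?_, ?_⟩
  · refine eq_top_iff.2 fun x _ => ?_
    -- These are the components of `x` for the eigenvalues `1`, `0` and `1/2`, in this order.
    have hx : x = φ x • a + (x - (2 : F) • (a * x) + φ x • a) + (2 : F) • (a * x - φ x • a) := by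
      module
    rw [hx]
    refine Submodule.add_mem_sup (Submodule.add_mem_sup ?_ ?_) ?_
    · rw [mem_adEigenspace, mul_smul_comm, ha.idem, one_smul]
    · rw [zero]
      simp only [mul_add, mul_sub, mul_smul_comm, ha.idem]
      linear_combination (norm := module) -ha.sq x
    · rw [half]
      simp only [mul_sub, mul_smul_comm, ha.idem]
      linear_combination (norm := module) (2 : F) • ha.sq x
  · intro x hx y hy
    obtain ⟨l, rfl⟩ := one x hx
    rw [smul_mul_assoc, mem_adEigenspace.1 hy, one_smul]
    exact Submodule.smul_mem _ _ hy
  · intro x hx y hy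
    obtain ⟨l, rfl⟩ := one x hx
    rw [smul_mul_assoc, (zero y).1 hy, smul_zero]
  · intro x hx y hy
    rw [zero] at *
    have h := ha.fusion x y
    simp only [hx, hy, mul_zero, ha.zero x y hx, smul_zero] at h
    linear_combination (norm := module) h
  · intro x hx y hy
    obtain ⟨l, rfl⟩ := one x hx
    rw [smul_mul_assoc, mem_adEigenspace.1 hy]
    exact Submodule.smul_mem _ _ (Submodule.smul_mem _ _ hy)
  · intro x hx y hy
    rw [zero] at hx
    rw [half] at *
    have h := ha.fusion x y
    simp only [hx, mul_zero, zero_mul, smul_zero, φ0 x hx, φh y hy, ha.zero x y hx, zero_smul, add_zero] at h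
    have := congrArg (fun t => x * t) hy
    simp only [mul_smul_comm] at this
    linear_combination (norm := module) (2 : F) • h + this
  · intro x hx y hy
    rw [half] at hx hy
    have h := ha.fusion x y
    have key : a * (x * y) = φ (x * y) • a := by
      have hxy : (4 : F) • ((a * x) * (a * y)) = x * y := by
        conv_rhs => rw [← hx, ← hy]
        simp only [smul_mul_assoc, mul_smul_comm]
        module
      have h1 : (2 : F) • (x * (a * y)) = x * y := by rw [← mul_smul_comm, hy]
      have h2 : (2 : F) • (y * (a * x)) = x * y := by rw [← mul_smul_comm, hx, mul_comm]
      rw [hxy, φh x hx, φh y hy] at h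
      refine smul_right_injective A ‹(2 : F) ≠ 0› ?_
      linear_combination (norm := module) (2 : F) • h + h1 + h2
    have : x * y = (x * y - φ (x * y) • a) + φ (x * y) • a := by module
    rw [this]
    refine Submodule.add_mem_sup ?_ ?_
    · rw [zero, mul_sub, mul_smul_comm, ha.idem, key, sub_self]
    · rw [mem_adEigenspace, mul_smul_comm, ha.idem, one_smul]

end PeirceAxis

end AxialJordan

/-! ### Miyamoto involutions and the Frobenius form -/

namespace AxialJordan

variable {F : Type*} [Field F] {A : Type*} [NonUnitalNonAssocCommRing A] [Module F A]
  [SMulCommClass F A A]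

/-- The Miyamoto map `x ↦ x - 4 a x + 4 φ(x) a` of an axis `a`. -/
def miyamoto (a : A) (φ : A →ₗ[F] F) : A →ₗ[F] A :=
  LinearMap.id - (4 : F) • LinearMap.mulLeft F a + (4 : F) • φ.smulRight a

theorem miyamoto_apply (a : A) (φ : A →ₗ[F] F) (x : A) :
    miyamoto a φ x = x - (4 : F) • (a * x) + (4 * φ x) • a := by
  simp [miyamoto, mul_smul]

theorem mul_eq_miyamoto (a : A) (φ : A →ₗ[F] F) (x : A) :
    (4 : F) • (a * x) = x - miyamoto a φ x + (4 * φ x) • a := by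
  rw [miyamoto_apply]; module

namespace PeirceAxis

variable {a b : A} {φ ψ : A →ₗ[F] F}

theorem apply_miyamoto (ha : PeirceAxis a φ) (x : A) : φ (miyamoto a φ x) = φ x := by
  simp only [miyamoto_apply, map_add, map_sub, map_smul, ha.apply_mul, ha.norm, smul_eq_mul]
  ring

/-- The fusion identities of `a` at `(b, b)` and of `b` at `(a, a)` both compute `4(ab)²`; comparing
them gives `(φ b - ψ a) ab = 0`. If `ab = 0`, both values are zero. -/
theorem apply_comm (two_ne : (2 : F) ≠ 0) (ha : PeirceAxis a φ) (hb : PeirceAxis b ψ) : φ b = ψ a := by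
  have h1 := ha.fusion b b
  have h2 := hb.fusion a a
  have h3 := ha.sq b
  have h4 := hb.sq a
  rw [mul_comm b a] at h2 h4
  rw [hb.idem] at h1
  rw [ha.idem, mul_comm b a] at h2
  have h : (φ b - ψ a) • (a * b) = 0 := by
    refine smul_right_injective A two_ne ?_
    linear_combination (norm := module) h2 - h1 + h3 - h4
  rcases smul_eq_zero.1 h with h | h
  · exact sub_eq_zero.1 h
  · rw [← ha.apply_mul b, ← hb.apply_mul a, mul_comm b a, h, map_zero, map_zero]

variable [IsScalarTower F A A]

theorem miyamoto_miyamoto (ha : PeirceAxis a φ) (x : A) :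
    miyamoto a φ (miyamoto a φ x) = x := by
  rw [miyamoto_apply, ha.apply_miyamoto, miyamoto_apply]
  simp only [mul_add, mul_sub, mul_smul_comm, ha.idem]
  linear_combination (norm := module) (8 : F) • ha.sq x

/-- The map is `-1` on the `1/2`-eigenspace and `1` on the other two, and the fusion law is graded
by this sign. -/
theorem miyamoto_mul (ha : PeirceAxis a φ) (x y : A) :
    miyamoto a φ (x * y) = miyamoto a φ x * miyamoto a φ y := by
  simp only [miyamoto_apply, mul_add, mul_sub, add_mul, sub_mul, mul_smul_comm, smul_mul_assoc,
    ha.idem, mul_comm x a, mul_comm (a * x) a, mul_comm (a * x) y]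
  linear_combination (norm := module) (-4 : F) • ha.fusion x y + (8 * φ y) • ha.sq x +
    (8 * φ x) • ha.sq y

theorem miyamoto_axis (ha : PeirceAxis a φ) (hb : PeirceAxis b ψ) :
    PeirceAxis (miyamoto a φ b) (ψ ∘ₗ miyamoto a φ) := by
  have key : ∀ x, miyamoto a φ b * x = miyamoto a φ (b * miyamoto a φ x) := fun x => by
    rw [ha.miyamoto_mul, ha.miyamoto_miyamoto]
  refine ⟨?_, ?_, fun x => ?_, fun x y h => ?_, fun x y => ?_⟩
  · rw [← ha.miyamoto_mul, hb.idem]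
  · rw [LinearMap.comp_apply, ha.miyamoto_miyamoto, hb.norm]
  · rw [key, key, ha.miyamoto_miyamoto, LinearMap.comp_apply, ← map_smul, hb.sq, map_add, map_smul]
  · rw [LinearMap.comp_apply, ha.miyamoto_mul]
    refine hb.zero _ _ ?_
    rw [← ha.miyamoto_miyamoto (b * _), ← key, h, map_zero]
  · have h := congrArg (miyamoto a φ) (hb.fusion (miyamoto a φ x) (miyamoto a φ y))
    simpa only [LinearMap.comp_apply, map_add, map_sub, map_smul, ha.miyamoto_mul, ha.miyamoto_miyamoto] using h

end PeirceAxis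

variable [IsScalarTower F A A]

/-- The primitive axes of Jordan type `1/2` of `A`. -/
def axes (F : Type*) [Field F] (A : Type*) [NonUnitalNonAssocCommRing A] [Module F A] : Set A :=
  {a | ∃ φ : A →ₗ[F] F, PeirceAxis a φ}

/-- By `mul_eq_miyamoto`, `ab` is a combination of `a`, `b` and the image of `b` under the
involution of `a`, so the span of the axes is closed under products. -/
theorem span_axes (h2 : (2 : F) ≠ 0) {X : Set A} (hX : X ⊆ axes F A)
    (hgen : NonUnitalAlgebra.adjoin F X = ⊤) : Submodule.span F (axes F A) = ⊤ := by
  have h4 : (4 : F) ≠ 0 := by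
    have : (4 : F) = 2 * 2 := by norm_num
    rw [this]; exact mul_ne_zero h2 h2
  have hmul : ∀ x ∈ Submodule.span F (axes F A), ∀ y ∈ Submodule.span F (axes F A),
      x * y ∈ Submodule.span F (axes F A) := by
    intro x hx y hy
    induction hx, hy using Submodule.span_induction₂ with
    | mem_mem a b ha hb =>
      obtain ⟨φ, ha'⟩ := ha
      obtain ⟨ψ, hb'⟩ := hb
      rw [← Submodule.smul_mem_iff _ h4, mul_eq_miyamoto a _]
      exact add_mem (sub_mem (Submodule.subset_span ⟨ψ, hb'⟩)
        (Submodule.subset_span ⟨_, ha'.miyamoto_axis hb'⟩))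
        (Submodule.smul_mem _ _ (Submodule.subset_span ⟨φ, ha'⟩))
    | zero_left y hy => simp
    | zero_right x hx => simp
    | add_left x y z _ _ _ h₁ h₂ => rw [add_mul]; exact add_mem h₁ h₂
    | add_right x y z _ _ _ h₁ h₂ => rw [mul_add]; exact add_mem h₁ h₂
    | smul_left r x y _ _ h => rw [smul_mul_assoc]; exact Submodule.smul_mem _ _ h
    | smul_right r x y _ _ h => rw [mul_smul_comm]; exact Submodule.smul_mem _ _ h
  refine eq_top_iff.2 fun x _ => ?_
  have hx : x ∈ NonUnitalAlgebra.adjoin F X := by rw [hgen]; trivial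
  induction hx using NonUnitalAlgebra.adjoin_induction with
  | mem x hx => exact Submodule.subset_span (hX hx)
  | add x y _ _ h₁ h₂ => exact add_mem (h₁ trivial) (h₂ trivial)
  | zero => exact zero_mem _
  | mul x y _ _ h₁ h₂ => exact hmul x (h₁ trivial) y (h₂ trivial)
  | smul r x _ h => exact Submodule.smul_mem _ _ (h trivial)

/-- Extending `a ↦ φ_a` linearly is well defined: by symmetry, the value of `∑ c_a φ_a` at an axis
`b` is `φ_b(∑ c_a a)`, which depends only on the sum. -/
theorem exists_form_of_span (h2 : (2 : F) ≠ 0) (h : Submodule.span F (axes F A) = ⊤) :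
    ∃ form : LinearMap.BilinForm F A, ∀ a ∈ axes F A, PeirceAxis a (form a) := by
  choose φ hφ using fun a : axes F A => a.2
  let T : (axes F A →₀ F) →ₗ[F] A := Finsupp.linearCombination F Subtype.val
  let G : (axes F A →₀ F) →ₗ[F] (A →ₗ[F] F) := Finsupp.linearCombination F φ
  have hT : LinearMap.range T = ⊤ := by
    rw [Finsupp.range_linearCombination, Subtype.range_coe, h]
  have hG : ∀ (f : axes F A →₀ F) (b : axes F A), G f b = φ b (T f) := by
    intro f b
    simp only [G, T, Finsupp.linearCombination_apply, Finsupp.sum, LinearMap.sum_apply, map_sum,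
      map_smul, LinearMap.smul_apply]
    exact Finset.sum_congr rfl fun a _ => by rw [(hφ a).apply_comm h2 (hφ b)]
  have hker : ∀ f, T f = 0 → G f = 0 := fun f hf => by
    refine LinearMap.ext_on h fun b hb => ?_
    rw [hG f ⟨b, hb⟩, hf, map_zero, LinearMap.zero_apply]
  obtain ⟨s, hs⟩ := T.exists_rightInverse_of_surjective hT
  refine ⟨G ∘ₗ s, fun a ha => ?_⟩
  have h1 : G (s a) = φ ⟨a, ha⟩ := by
    have h3 := hker (s a - Finsupp.single ⟨a, ha⟩ 1) <| by
      rw [map_sub, ← LinearMap.comp_apply, hs]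
      simp [T]
    rw [map_sub, sub_eq_zero] at h3
    rw [h3]
    simp [G]
  rw [LinearMap.comp_apply, h1]
  exact hφ ⟨a, ha⟩

/-- A bilinear form is Frobenius and restricts to the `1`-component functional of every axis. -/
structure IsAxialForm (form : LinearMap.BilinForm F A) : Prop where
  axis : ∀ a ∈ axes F A, PeirceAxis a (form a)
  comm : ∀ x y, form x y = form y x
  assoc : ∀ x y z, form x (y * z) = form (x * y) z

theorem exists_isAxialForm (h2 : (2 : F) ≠ 0) (h : Submodule.span F (axes F A) = ⊤) :
    ∃ form : LinearMap.BilinForm F A, IsAxialForm form := by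
  obtain ⟨form, hf⟩ := exists_form_of_span h2 h
  have h4 : (4 : F) ≠ 0 := by
    have : (4 : F) = 2 * 2 := by norm_num
    rw [this]; exact mul_ne_zero h2 h2
  have comm : ∀ x y, form x y = form y x := by
    suffices form = form.flip from fun x y => LinearMap.congr_fun₂ this x y
    refine LinearMap.ext_on h fun a ha => LinearMap.ext_on h fun b hb => ?_
    change form a b = form b a
    exact (hf a ha).apply_comm h2 (hf b hb)
  have mul : ∀ a ∈ axes F A, ∀ b ∈ axes F A, ∀ c ∈ axes F A,
      form b (a * c) = form (a * b) c := by
    intro a ha b hb c hc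
    have ha' := hf a ha
    -- Invariance under the involution of `a` follows from uniqueness of the functional of an axis.
    -- As multiplication by `a` is expressed through this involution and the form, invariance makes
    -- it self-adjoint.
    have key : ∀ b ∈ axes F A, form (miyamoto a (form a) b) = form b ∘ₗ miyamoto a (form a) :=
      fun b hb => by
        have hm := ha'.miyamoto_axis (hf b hb)
        exact (hf _ ⟨_, hm⟩).unique hm
    have h1 : form b (miyamoto a (form a) c) = form (miyamoto a (form a) b) c := by
      rw [key b hb, LinearMap.comp_apply]
    have h5 := congrArg (form b) (mul_eq_miyamoto a (form a) c)
    have h6 := congrArg (fun t => form t c) (mul_eq_miyamoto a (form a) b)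
    simp only [map_add, map_sub, map_smul, LinearMap.add_apply, LinearMap.sub_apply,
      LinearMap.smul_apply, smul_eq_mul] at h5 h6
    refine mul_left_cancel₀ h4 ?_
    rw [h5, h6, h1, comm b a]
    ring
  have mul' : ∀ a ∈ axes F A, ∀ x y, form x (a * y) = form (a * x) y := by
    intro a ha
    suffices form.compl₂ (LinearMap.mulLeft F a) = form ∘ₗ LinearMap.mulLeft F a from
      fun x y => LinearMap.congr_fun₂ this x y
    refine LinearMap.ext_on h fun b hb => LinearMap.ext_on h fun c hc => ?_
    exact mul a ha b hb c hc
  refine ⟨form, hf, comm, fun x y z => ?_⟩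
  have hy : y ∈ Submodule.span F (axes F A) := by rw [h]; trivial
  induction hy using Submodule.span_induction with
  | mem a ha => rw [mul' a ha, mul_comm a x]
  | zero => simp
  | add u v _ _ hu hv => simp only [add_mul, mul_add, map_add, LinearMap.add_apply, hu, hv]
  | smul r u _ hu => simp only [smul_mul_assoc, mul_smul_comm, map_smul, LinearMap.smul_apply, hu]

/-- Pairing `2a(ax) = ax + φ(x)a` with `a` forces `(a, x) = φ(x)` for generators, and associativity
carries the equality to products. -/
theorem IsFrobeniusForm.eq_of_isFrobeniusForm {X : Set A}
    (hX : X ⊆ axes F A) (hgen : NonUnitalAlgebra.adjoin F X = ⊤)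
    {B C : LinearMap.BilinForm F A} (hB : IsFrobeniusForm F X B) (hC : IsFrobeniusForm F X C) :
    B = C := by
  have key : ∀ D : LinearMap.BilinForm F A, IsFrobeniusForm F X D → ∀ a ∈ X,
      ∀ φ : A →ₗ[F] F, PeirceAxis a φ → D a = φ := by
    intro D hD a haX φ ha
    ext x
    have h1 : ∀ y, D a (a * y) = D a y := fun y => by rw [hD.assoc, ha.idem]
    have h3 := congrArg (D a) (ha.sq x)
    simp only [map_add, map_smul, h1, hD.normalised a haX, smul_eq_mul] at h3
    linear_combination h3
  refine LinearMap.ext fun x => ?_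
  have hx : x ∈ NonUnitalAlgebra.adjoin F X := by rw [hgen]; trivial
  induction hx using NonUnitalAlgebra.adjoin_induction with
  | mem a ha =>
    obtain ⟨φ, hφ⟩ := hX ha
    rw [key B hB a ha φ hφ, key C hC a ha φ hφ]
  | add x y _ _ h₁ h₂ => rw [map_add, map_add, h₁, h₂]
  | zero => simp
  | mul x y _ _ h₁ h₂ => ext z; rw [← hB.assoc, ← hC.assoc, h₁]
  | smul r x _ h => rw [map_smul, map_smul, h]

end AxialJordan

/-! ### The axis condition as a quadratic function of the idempotent -/

namespace AxialJordan

variable {F : Type*} [Field F] {A : Type*} [NonUnitalNonAssocCommRing A] [Module F A]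
  [SMulCommClass F A A] [IsScalarTower F A A]

/-- The bilinear part, in the idempotent, of the eigenvalue condition on an axis. -/
def sqPart (form : LinearMap.BilinForm F A) (x : A) : A →ₗ[F] A →ₗ[F] A :=
  LinearMap.mk₂ F (fun c d => (2 : F) • (c * (d * x)) - form d x • c)
    (fun _ _ _ => by simp only [add_mul, smul_add]; abel)
    (fun _ _ _ => by simp only [smul_mul_assoc]; module)
    (fun _ _ _ => by simp only [add_mul, mul_add, map_add, LinearMap.add_apply]; module)
    (fun _ _ _ => by
      simp only [smul_mul_assoc, mul_smul_comm, map_smul, LinearMap.smul_apply, smul_eq_mul]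
      module)

/-- The bilinear part, in the idempotent, of the fusion condition on an axis. -/
def fusionPart (form : LinearMap.BilinForm F A) (x y : A) : A →ₗ[F] A →ₗ[F] A :=
  LinearMap.mk₂ F (fun c d => (4 : F) • ((c * x) * (d * y)) - form d y • (c * x)
      - form c x • (d * y) - form c (x * y) • d)
    (fun _ _ _ => by simp only [add_mul, map_add, LinearMap.add_apply]; module)
    (fun _ _ _ => by
      simp only [smul_mul_assoc, map_smul, LinearMap.smul_apply, smul_eq_mul]
      module)
    (fun _ _ _ => by simp only [add_mul, mul_add, map_add, LinearMap.add_apply]; module)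
    (fun _ _ _ => by
      simp only [smul_mul_assoc, mul_smul_comm, map_smul, LinearMap.smul_apply, smul_eq_mul]
      module)

/-- The linear part, in the idempotent, of the fusion condition on an axis. -/
def fusionLinearPart (F : Type*) [Field F] [Module F A] [SMulCommClass F A A]
    [IsScalarTower F A A] (x y : A) : A →ₗ[F] A :=
  LinearMap.mulRight F (x * y) - LinearMap.mulLeft F x ∘ₗ LinearMap.mulRight F y
    - LinearMap.mulLeft F y ∘ₗ LinearMap.mulRight F x

variable {form : LinearMap.BilinForm F A}

theorem sqPart_apply (x c d : A) :
    sqPart form x c d = (2 : F) • (c * (d * x)) - form d x • c := rfl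

theorem fusionPart_apply (x y c d : A) :
    fusionPart form x y c d = (4 : F) • ((c * x) * (d * y)) - form d y • (c * x)
      - form c x • (d * y) - form c (x * y) • d := rfl

theorem fusionLinearPart_apply (x y c : A) :
    fusionLinearPart F x y c = c * (x * y) - x * (c * y) - y * (c * x) := rfl

namespace IsAxialForm

theorem sqPart_axis (h : IsAxialForm form) {a : A} (ha : a ∈ axes F A) (x : A) :
    sqPart form x a a + (-LinearMap.mulRight F x) a = 0 := by
  rw [sqPart_apply, LinearMap.neg_apply, LinearMap.mulRight_apply, (h.axis a ha).sq]
  module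

theorem fusionPart_axis (h : IsAxialForm form) {a : A} (ha : a ∈ axes F A) (x y : A) :
    fusionPart form x y a a + fusionLinearPart F x y a = 0 := by
  rw [fusionPart_apply, fusionLinearPart_apply, (h.axis a ha).fusion]
  module

/-- The condition `zero` need not be tested, since `(c, xy) = (cx, y)`; the rest is quadratic in `c`
without constant term. -/
theorem peirceAxis_of_quadratic (h : IsAxialForm form) {c : A} (idem : c * c = c) (norm : form c c = 1)
    (hs : ∀ x, sqPart form x c c + (-LinearMap.mulRight F x) c = 0)
    (hf : ∀ x y, fusionPart form x y c c + fusionLinearPart F x y c = 0) :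
    PeirceAxis c (form c) where
  idem := idem
  norm := norm
  sq x := by
    have := hs x
    rw [sqPart_apply, LinearMap.neg_apply, LinearMap.mulRight_apply] at this
    linear_combination (norm := module) this
  zero x y hx := by rw [h.assoc, hx, map_zero, LinearMap.zero_apply]
  fusion x y := by
    have := hf x y
    rw [fusionPart_apply, fusionLinearPart_apply] at this
    linear_combination (norm := module) this

end IsAxialForm

/-! ### The two-generated subalgebra and interpolation on its conic -/

/-- A multiple of the identity of `⟨⟨a, b⟩⟩` when `(a, b) ≠ 1`, and an annihilator otherwise. -/
def center (F : Type*) [Field F] [Module F A] (a b : A) : A := (2 : F) • (a * b) - a - b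

theorem center_comm (a b : A) : center F a b = center F b a := by
  rw [center, center, mul_comm a b]; abel

namespace IsAxialForm

variable {a b : A}

theorem mul_center (h : IsAxialForm form) (ha : a ∈ axes F A) : a * center F a b = (form a b - 1) • a := by
  have := (h.axis a ha).sq b
  simp only [center, mul_sub, mul_smul_comm, (h.axis a ha).idem]
  linear_combination (norm := module) this

theorem right_mul_center (h : IsAxialForm form) (hb : b ∈ axes F A) :
    b * center F a b = (form a b - 1) • b := by
  rw [center_comm, h.mul_center hb, h.comm]

/-- The only product not covered by the actions of `a` and `b` is `(ab)²`, given by the fusion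
identity of `a` at `(b, b)`. -/
theorem center_mul_center (h : IsAxialForm form) (ha : a ∈ axes F A) (hb : b ∈ axes F A) :
   
    center F a b * center F a b = (form a b - 1) • center F a b := by
  have h1 := (h.axis a ha).fusion b b
  have h2 := (h.axis a ha).sq b
  have h3 := (h.axis b hb).sq a
  have h4 := h.mul_center ha (b := b)
  have h5 := h.right_mul_center hb (a := a)
  rw [(h.axis b hb).idem] at h1
  rw [mul_comm b a, h.comm b a] at h3
  have h6 : center F a b * center F a b = (2 : F) • ((a * b) * center F a b)
      - a * center F a b - b * center F a b := by
    conv_lhs => enter [1]; rw [center]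
    rw [sub_mul, sub_mul, smul_mul_assoc]
  have h7 : (a * b) * center F a b = (2 : F) • ((a * b) * (a * b)) - a * (a * b) - b * (a * b) := by
    simp only [center, mul_sub, mul_smul_comm, mul_comm (a * b) a, mul_comm (a * b) b]
  rw [h6, h7, h4, h5, center]
  linear_combination (norm := module) h1 - h2

end IsAxialForm

namespace IsAxialForm

variable {a b : A}

theorem miyamoto_mem_axes (h : IsAxialForm form) (ha : a ∈ axes F A) (hb : b ∈ axes F A) :
    miyamoto a (form a) b ∈ axes F A :=
  ⟨_, (h.axis a ha).miyamoto_axis (h.axis b hb)⟩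

theorem miyamoto_eq (a b : A) :
    miyamoto a (form a) b = (4 * form a b - 2) • a - b - (2 : F) • center F a b := by
  rw [miyamoto_apply, center]; module

theorem reflection_mem_axes (h : IsAxialForm form) (ha : a ∈ axes F A) (hb : b ∈ axes F A) :
    (4 * form a b - 2) • a - b - (2 : F) • center F a b ∈ axes F A := by
  rw [← miyamoto_eq]; exact h.miyamoto_mem_axes ha hb

theorem reflection_mem_axes' (h : IsAxialForm form) (ha : a ∈ axes F A) (hb : b ∈ axes F A) :
    (4 * form a b - 2) • b - a - (2 : F) • center F a b ∈ axes F A := by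
  rw [center_comm, h.comm a b]; exact h.reflection_mem_axes hb ha

theorem apply_center (h : IsAxialForm form) (ha : a ∈ axes F A) :
    form a (center F a b) = form a b - 1 := by
  simp only [center, map_sub, map_smul, smul_eq_mul, (h.axis a ha).apply_mul, (h.axis a ha).norm]
  ring

theorem miyamoto_center (h : IsAxialForm form) (ha : a ∈ axes F A) :
    miyamoto a (form a) (center F a b) = center F a b := by
  rw [miyamoto_apply, h.mul_center ha, h.apply_center ha]; module

theorem double_reflection_mem_axes (h : IsAxialForm form) (ha : a ∈ axes F A)
    (hb : b ∈ axes F A) :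
    ((4 * form a b - 2) ^ 2 - 1) • a - (4 * form a b - 2) • b
      - (2 * (4 * form a b - 2) + 2) • center F a b ∈ axes F A := by
  have h1 := h.miyamoto_mem_axes ha (h.reflection_mem_axes' ha hb)
  have h2 : miyamoto a (form a) a = a := by
    rw [miyamoto_apply, (h.axis a ha).idem, (h.axis a ha).norm]; module
  rw [map_sub, map_sub, map_smul, map_smul, h.miyamoto_center ha, h2, miyamoto_eq] at h1
  convert h1 using 1
  module

/-- A vector-valued quadratic function that vanishes on the axes vanishes on the whole conic of
idempotents of `⟨⟨a, b⟩⟩` if `(a, b)` is neither `1/4` nor `1/2`. -/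
theorem quadratic_eq_zero (h : IsAxialForm form) (two_ne : (2 : F) ≠ 0) (ha : a ∈ axes F A)
    (hb : b ∈ axes F A) (h4 : 4 * form a b - 1 ≠ 0) (h2 : 2 * form a b - 1 ≠ 0)
    (B : A →ₗ[F] A →ₗ[F] A) (L : A →ₗ[F] A) (hBL : ∀ e ∈ axes F A, B e e + L e = 0)
    {x y r : F} (h1 : x + y + 2 * (form a b - 1) * r = 1)
    (hxy : x * y = r * (x + y + (form a b - 1) * r)) :
    B (x • a + y • b + r • center F a b) (x • a + y • b + r • center F a b)
      + L (x • a + y • b + r • center F a b) = 0 := by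
  have ea := hBL a ha
  have eb := hBL b hb
  have e1 := hBL _ (h.reflection_mem_axes ha hb)
  have e2 := hBL _ (h.reflection_mem_axes' ha hb)
  have e3 := hBL _ (h.double_reflection_mem_axes ha hb)
  generalize center F a b = ρ at *
  generalize form a b = α at *
  simp only [map_add, map_sub, map_smul, LinearMap.add_apply, LinearMap.sub_apply,
    LinearMap.smul_apply] at e1 e2 e3 ⊢
  -- Make `L` quadratic by multiplying it with the linear form `x + y + 2(α - 1)r`, which is `1` on
  -- the conic, and eliminate `xy` by the conic equation. As the function vanishes at `a` and `b`,
  -- what remains is `r(x l₁ + y l₂ + r l₃)`, and the other three axes give the linear equations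
  -- `f1`, `f2`, `f3` for its coefficients.
  obtain ⟨q, hq⟩ : ∃ q, q = B a b + B b a + L a + L b := ⟨_, rfl⟩
  obtain ⟨l₁, hl₁⟩ : ∃ l, l = B a ρ + B ρ a + L ρ + (2 * (α - 1)) • L a + q := ⟨_, rfl⟩
  obtain ⟨l₂, hl₂⟩ : ∃ l, l = B b ρ + B ρ b + L ρ + (2 * (α - 1)) • L b + q := ⟨_, rfl⟩
  obtain ⟨l₃, hl₃⟩ : ∃ l, l = B ρ ρ + (2 * (α - 1)) • L ρ + (α - 1) • q := ⟨_, rfl⟩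
  have f1 : (4 * α - 2) • l₁ - l₂ - (2 : F) • l₃ = 0 := by
    refine smul_right_injective A two_ne ?_
    subst hl₁ hl₂ hl₃ hq
    linear_combination (norm := module) -e1 + (4 * α - 2) ^ 2 • ea + eb
  have f2 : (4 * α - 2) • l₂ - l₁ - (2 : F) • l₃ = 0 := by
    refine smul_right_injective A two_ne ?_
    subst hl₁ hl₂ hl₃ hq
    linear_combination (norm := module) -e2 + (4 * α - 2) ^ 2 • eb + ea
  have f3 : ((4 * α - 2) ^ 2 - 1) • l₁ - (4 * α - 2) • l₂ - (2 * (4 * α - 2) + 2) • l₃ = 0 := by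
    refine smul_right_injective A (mul_ne_zero two_ne h4) ?_
    subst hl₁ hl₂ hl₃ hq
    linear_combination (norm := module) -e3 + ((4 * α - 2) ^ 2 - 1) ^ 2 • ea
      + (4 * α - 2) ^ 2 • eb
  have g12 : l₁ = l₂ := by
    refine smul_right_injective A h4 ?_
    linear_combination (norm := module) f1 - f2
  have g1 : l₁ = 0 := by
    refine smul_right_injective A (mul_ne_zero two_ne h2) ?_
    subst g12
    linear_combination (norm := module) (4 * α - 1) • f1 - f3
  have g3 : l₃ = 0 := by
    refine smul_right_injective A two_ne ?_
    subst g12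
    linear_combination (norm := module) (4 * α - 3) • g1 - f1
  subst g12
  have k1 := congrArg (· • (x • L a + y • L b + r • L ρ)) h1
  have k2 := congrArg (· • q) hxy
  beta_reduce at k1 k2
  rw [hl₁] at g1
  rw [hl₁] at hl₂
  rw [hl₃] at g3
  subst hq
  linear_combination (norm := module) x ^ 2 • ea + y ^ 2 • eb - k1 + k2 + (r * x + r * y) • g1
    - (r * y) • hl₂ + r ^ 2 • g3

/-- The analogue of `quadratic_eq_zero` for the affine line of idempotents through `a` and `b`
when `2 a b = a + b`. -/
theorem quadratic_eq_zero_of_center_eq_zero (h : IsAxialForm form) (two_ne : (2 : F) ≠ 0)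
    (ha : a ∈ axes F A) (hb : b ∈ axes F A) (hc : center F a b = 0)
    (B : A →ₗ[F] A →ₗ[F] A) (L : A →ₗ[F] A) (hBL : ∀ e ∈ axes F A, B e e + L e = 0)
    {x y : F} (h1 : x + y = 1) : B (x • a + y • b) (x • a + y • b) + L (x • a + y • b) = 0 := by
  have hα : form a b = 1 := by
    have := h.apply_center ha (b := b)
    rw [hc, map_zero] at this
    linear_combination -this
  have ea := hBL a ha
  have eb := hBL b hb
  -- Here this axis is `2a - b`, a third point of the line through `a` and `b`; three points
  -- determine a quadratic function on a line.
  have e1 := hBL _ (h.reflection_mem_axes ha hb)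
  obtain rfl : y = 1 - x := by linear_combination h1
  rw [hα, hc] at e1
  simp only [map_add, map_sub, map_smul, map_zero, LinearMap.add_apply, LinearMap.sub_apply,
    LinearMap.smul_apply, LinearMap.zero_apply] at e1 ⊢
  refine smul_right_injective A two_ne ?_
  linear_combination (norm := module) (-(x * (1 - x))) • e1 + (2 * x ^ 2 + 4 * x * (1 - x)) • ea
    + (2 * (1 - x) ^ 2 + x * (1 - x)) • eb

end IsAxialForm

/-! ### The right-angle case `(a, b) = 1/2` -/

/-- `a` and `z - a` are orthogonal axes with sum `z`. -/
structure IsAxisPair (form : LinearMap.BilinForm F A) (a z : A) : Prop where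
  form : IsAxialForm form
  left : a ∈ axes F A
  right : z - a ∈ axes F A
  mul : a * z = a

namespace IsAxisPair

variable {a z : A}

theorem idem (h : IsAxisPair form a z) : z * z = z := by
  have h1 := (h.form.axis _ h.right).idem
  simp only [mul_sub, sub_mul, h.mul, mul_comm z a, (h.form.axis _ h.left).idem] at h1
  linear_combination (norm := module) h1

theorem apply_mul (h : IsAxisPair form a z) (x : A) : form a (z * x) = form a x := by
  rw [h.form.assoc, h.mul]

theorem apply_self (h : IsAxisPair form a z) (x : A) : form z (z * x) = form z x := by
  rw [h.form.assoc, h.idem]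

theorem sq_left (h : IsAxisPair form a z) (x : A) :
    (2 : F) • (a * (a * x)) = a * x + form a x • a := (h.form.axis _ h.left).sq x

/-- This is the fusion identity of `a` at `(z, x)`, simplified by `az = a` and the quadratic
relation for `a`. -/
theorem mul_left_comm (h : IsAxisPair form a z) (x : A) : a * (z * x) = z * (a * x) := by
  have h1 := (h.form.axis _ h.left).fusion z x
  have h2 := (h.form.axis _ h.left).sq x
  have h3 : form a z = 1 := by
    rw [← (h.form.axis _ h.left).apply_mul, h.mul, (h.form.axis _ h.left).norm]
  rw [h.mul, h.apply_mul, h3, mul_comm x a] at h1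
  linear_combination (norm := module) h1 - (2 : F) • h2

theorem sq_right (h : IsAxisPair form a z) (x : A) :
    (2 : F) • (z * (z * x)) = (4 : F) • (z * (a * x)) - (2 : F) • (a * x) + z * x
      - form a x • z - form z x • a + form z x • z := by
  have h1 := (h.form.axis _ h.right).sq x
  have h2 := h.sq_left x
  have h3 := h.mul_left_comm x
  simp only [mul_sub, sub_mul, map_sub, LinearMap.sub_apply] at h1
  linear_combination (norm := module) h1 - h2 + (2 : F) • h3

theorem mul_diff (h : IsAxisPair form a z) (x : A) :
    (4 : F) • (z * (((2 : F) • a - z) * x)) = (2 : F) • (((2 : F) • a - z) * x)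
      + form ((2 : F) • a - z) x • z + form z x • ((2 : F) • a - z) := by
  have h1 := h.sq_right x
  simp only [sub_mul, mul_sub, smul_mul_assoc, mul_smul_comm, map_sub, map_smul,
    LinearMap.sub_apply, LinearMap.smul_apply, smul_eq_mul]
  linear_combination (norm := module) (-2 : F) • h1

theorem diff_mul_comm (h : IsAxisPair form a z) (x : A) :
    ((2 : F) • a - z) * (z * x) = z * (((2 : F) • a - z) * x) := by
  simp only [sub_mul, mul_sub, smul_mul_assoc, mul_smul_comm, h.mul_left_comm]

/-- Multiplication by `z` is thus annihilated by `t(t - 1)(2t - 1)`, which gives a Peirce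
decomposition with respect to `z`. -/
theorem mul_mul_mul (h : IsAxisPair form a z) (x : A) :
    (2 : F) • (z * (z * (z * x))) = (3 : F) • (z * (z * x)) - z * x := by
  have h1 := h.sq_right x
  have h2 := congrArg (z * ·) h1
  have h3 := h.sq_right (a * x)
  have h4 := congrArg (z * ·) (h.sq_left x)
  have h5 := h.sq_left x
  have hz : form z (a * x) = form a x := by rw [h.form.assoc, mul_comm z a, h.mul]
  simp only [mul_sub, mul_add, mul_smul_comm, h.idem, mul_comm z a, h.mul, hz,
    (h.form.axis _ h.left).apply_mul] at h2 h3 h4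
  linear_combination (norm := module) h2 - h1 + (2 : F) • h3 + (4 : F) • h4 - (2 : F) • h5

theorem apply_eq_zero (h : IsAxisPair form a z) {x : A} (hx : (2 : F) • (z * x) = x) :
    form a x = 0 := by
  have h1 := congrArg (form a) hx
  rw [map_smul, h.apply_mul, smul_eq_mul] at h1
  linear_combination h1

theorem apply_eq_zero' (h : IsAxisPair form a z) {x : A} (hx : (2 : F) • (z * x) = x) :
    form z x = 0 := by
  have h1 := congrArg (form z) hx
  rw [map_smul, h.apply_self, smul_eq_mul] at h1
  linear_combination h1

theorem diff_mul_diff_mul (h : IsAxisPair form a z) {x : A} (hx : (2 : F) • (z * x) = x) :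
    (4 : F) • (((2 : F) • a - z) * (((2 : F) • a - z) * x)) = x := by
  have h1 := h.sq_left x
  have h2 := h.sq_right x
  have h3 := congrArg (z * ·) hx
  simp only [sub_mul, mul_sub, smul_mul_assoc, mul_smul_comm, h.mul_left_comm,
    h.apply_eq_zero hx, h.apply_eq_zero' hx] at h1 h2 h3 ⊢
  linear_combination (norm := module) (8 : F) • h1 + (4 : F) • h2 - (2 : F) • h3 + hx

theorem diff_mul_mul_diff_mul (h : IsAxisPair form a z) {x y : A}
    (hx : (2 : F) • (z * x) = x) (hy : (2 : F) • (z * y) = y) :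
    (8 : F) • ((((2 : F) • a - z) * x) * (((2 : F) • a - z) * y)) =
      (2 * form ((2 : F) • a - z) (x * y)) • ((2 : F) • a - z) + (2 : F) • (x * y)
      + form x y • z - (4 : F) • (z * (x * y)) := by
  have h1 := (h.form.axis _ h.left).fusion x y
  have h2 := (h.form.axis _ h.right).fusion x y
  have h3 : (2 : F) • (x * (z * y)) = x * y := by rw [← mul_smul_comm, hy]
  have h4 : (2 : F) • (y * (z * x)) = x * y := by rw [← mul_smul_comm, hx, mul_comm]
  have h5 : (4 : F) • ((z * x) * (z * y)) = x * y := by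
    have : (4 : F) • ((z * x) * (z * y)) = ((2 : F) • (z * x)) * ((2 : F) • (z * y)) := by
      rw [smul_mul_assoc, mul_smul_comm, smul_smul]; norm_num
    rw [this, hx, hy]
  have h6 : (2 : F) * form z (x * y) = form x y := by
    rw [h.form.assoc, ← smul_eq_mul, ← LinearMap.smul_apply, ← map_smul, hx]
  simp only [sub_mul, mul_sub, smul_mul_assoc, mul_smul_comm, map_sub, map_smul,
    LinearMap.sub_apply, LinearMap.smul_apply, smul_eq_mul, h.apply_eq_zero hx, h.apply_eq_zero hy,
    h.apply_eq_zero' hx, h.apply_eq_zero' hy] at h1 h2 ⊢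
  rw [← h6]
  linear_combination (norm := module) (4 : F) • h1 + (4 : F) • h2 + (2 : F) • h3 + (2 : F) • h4
    - (2 : F) • h5

/-- The polynomial `4t - 4t²` is `1` at `1/2` and `0` at `0` and `1`, so it projects onto the
`1/2`-eigenspace of `z`. -/
theorem mul_halfPart (h : IsAxisPair form a z) (x : A) :
    (2 : F) • (z * ((4 : F) • (z * x) - (4 : F) • (z * (z * x)))) =
      (4 : F) • (z * x) - (4 : F) • (z * (z * x)) := by
  simp only [mul_sub, mul_smul_comm]
  linear_combination (norm := module) (-4 : F) • h.mul_mul_mul x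

theorem diff_mul_sub_halfPart (h : IsAxisPair form a z) (x : A) :
    (2 : F) • (((2 : F) • a - z) * (x - ((4 : F) • (z * x) - (4 : F) • (z * (z * x))))) =
      form z x • ((2 : F) • a - z) + form ((2 : F) • a - z) x • z := by
  have h1 := h.mul_diff x
  have h2 := h.mul_diff (z * x)
  simp only [h.diff_mul_comm, map_sub, map_smul, LinearMap.sub_apply, LinearMap.smul_apply,
    h.apply_mul, h.apply_self] at h1 h2 ⊢
  rw [mul_sub, mul_sub, mul_smul_comm, mul_smul_comm, h.diff_mul_comm, h.diff_mul_comm,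
    h.diff_mul_comm]
  linear_combination (norm := module) (2 : F) • h2 - h1

theorem apply_sub_halfPart (h : IsAxisPair form a z) (x : A) :
    form a (x - ((4 : F) • (z * x) - (4 : F) • (z * (z * x)))) = form a x := by
  simp only [map_sub, map_smul, h.apply_mul, smul_eq_mul]
  ring

theorem apply_self_sub_halfPart (h : IsAxisPair form a z) (x : A) :
    form z (x - ((4 : F) • (z * x) - (4 : F) • (z * (z * x)))) = form z x := by
  simp only [map_sub, map_smul, h.apply_self, smul_eq_mul]
  ring

end IsAxisPair

/-- Axes `a`, `b` with `(a, b) = 1/2`, where `z` is the identity of `⟨⟨a, b⟩⟩`. -/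
structure IsRightAngle (form : LinearMap.BilinForm F A) (a b z : A) : Prop where
  left : IsAxisPair form a z
  right : IsAxisPair form b z
  mul : (4 : F) • (a * b) = (2 : F) • a + (2 : F) • b - z
  inner : 2 * form a b = 1

namespace IsRightAngle

variable {a b z : A}

/-- The fusion identity of `a` at `(b, x)` is the source, with `ab` replaced by its value in the
span of `a`, `b`, `z`. On the `1/2`-eigenspace of `z` the right side vanishes and the two
multiplications anticommute. -/
theorem anticomm (h : IsRightAngle form a b z) (x : A) :
    (2 : F) • (((2 : F) • a - z) * (((2 : F) • b - z) * x)
      + ((2 : F) • b - z) * (((2 : F) • a - z) * x)) =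
      form ((2 : F) • a - z) x • ((2 : F) • b - z)
        + form ((2 : F) • b - z) x • ((2 : F) • a - z) := by
  have f := (h.left.form.axis _ h.left.left).fusion b x
  have f1 := congrArg (· * (a * x)) h.mul
  have f2 := congrArg (· * x) h.mul
  have f3 := congrArg (fun t => form t x) h.mul
  have f4 := congrArg (· • (a * x)) h.inner
  have f5 := congrArg (form a x • ·) h.mul
  rw [h.left.form.assoc, mul_comm x (a * b)] at f
  simp only [sub_mul, add_mul, smul_mul_assoc, map_add, map_sub, map_smul, LinearMap.add_apply,
    LinearMap.sub_apply, LinearMap.smul_apply, smul_eq_mul] at f1 f2 f3 f4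
  have f6 := congrArg (· • a) f3
  have g1 := h.left.sq_left x
  have g2 := h.right.sq_right x
  beta_reduce at f5 f6
  simp only [sub_mul, mul_sub, smul_mul_assoc, mul_smul_comm, map_sub, map_smul,
    LinearMap.sub_apply, LinearMap.smul_apply, smul_eq_mul, h.left.mul_left_comm,
    h.right.mul_left_comm]
  linear_combination (norm := module) (8 : F) • f - (8 : F) • f1 + (2 : F) • f2 + (2 : F) • f5
    + (4 : F) • f4 + (2 : F) • f6 - (8 : F) • g1 + (2 : F) • g2

theorem diff_mul_diff (h : IsRightAngle form a b z) :
    ((2 : F) • a - z) * ((2 : F) • b - z) = 0 := by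
  simp only [sub_mul, mul_sub, smul_mul_assoc, mul_smul_comm, mul_comm z b, h.left.mul,
    h.right.mul, h.left.idem]
  linear_combination (norm := module) h.mul

theorem sqPart_diff (h : IsRightAngle form a b z) (x : A) :
    sqPart form x ((2 : F) • a - z) ((2 : F) • b - z)
      + sqPart form x ((2 : F) • b - z) ((2 : F) • a - z) = 0 := by
  rw [sqPart_apply, sqPart_apply]
  linear_combination (norm := module) h.anticomm x

end IsRightAngle

theorem fusionPart_add_left (v w x x' y : A) : fusionPart form (x + x') y v w =
    fusionPart form x y v w + fusionPart form x' y v w := by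
  simp only [fusionPart_apply, add_mul, mul_add, map_add]; module

theorem fusionPart_add_right (v w x y y' : A) : fusionPart form x (y + y') v w =
    fusionPart form x y v w + fusionPart form x y' v w := by
  simp only [fusionPart_apply, mul_add, map_add]; module

theorem fusionPart_swap (v w x y : A) : fusionPart form x y v w + fusionPart form x y w v =
    fusionPart form y x v w + fusionPart form y x w v := by
  simp only [fusionPart_apply, mul_comm y x, mul_comm (v * y), mul_comm (w * y)]
  module

/-- Vanishing of the polarised fusion condition when both arguments are orthogonal to the
`1/2`-eigenspace of `z`. -/
theorem fusionPart_pure (hf : IsAxialForm form) {v w z x y : A} (hz : z * z = z) (hzv : z * v = v)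
    (hzw : z * w = w) (hvw : v * w = 0) (two_ne : (2 : F) ≠ 0)
    (hvx : (2 : F) • (v * x) = form z x • v + form v x • z)
    (hwx : (2 : F) • (w * x) = form z x • w + form w x • z)
    (hvy : (2 : F) • (v * y) = form z y • v + form v y • z)
    (hwy : (2 : F) • (w * y) = form z y • w + form w y • z) :
    fusionPart form x y v w + fusionPart form x y w v = 0 := by
  have e1 : (4 : F) • ((v * x) * (w * y)) =
      (form z x • v + form v x • z) * (form z y • w + form w y • z) := by
    rw [← hvx, ← hwy, smul_mul_assoc, mul_smul_comm, smul_smul]; norm_num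
  have e2 : (4 : F) • ((w * x) * (v * y)) =
      (form z x • w + form w x • z) * (form z y • v + form v y • z) := by
    rw [← hvy, ← hwx, smul_mul_assoc, mul_smul_comm, smul_smul]; norm_num
  have e3 : 2 * form v (x * y) = form z x * form v y + form v x * form z y := by
    have := congrArg (fun t => form t y) hvx
    simpa [hf.assoc v x y] using this
  have e4 : 2 * form w (x * y) = form z x * form w y + form w x * form z y := by
    have := congrArg (fun t => form t y) hwx
    simpa [hf.assoc w x y] using this
  simp only [mul_add, add_mul, smul_mul_assoc, mul_smul_comm, hz, hzv, hzw, hvw, mul_comm v z,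
    mul_comm w v, mul_comm w z] at e1 e2
  have e5 := congrArg (· • w) e3
  have e6 := congrArg (· • v) e4
  beta_reduce at e5 e6
  refine smul_right_injective A two_ne ?_
  simp only [fusionPart_apply]
  linear_combination (norm := module) (2 : F) • e1 + (2 : F) • e2 - e5 - e6
    - form v y • hwx - form w y • hvx - form v x • hwy - form w x • hvy

/-- Since `vx` lies in the span of `v` and `z`, and `wx` in that of `w` and `z`, all products reduce
to multiplications by `v`, `w`, `z` on `vy` and `wy`; anticommutation cancels the remainder. -/
theorem fusionPart_mixed (hf : IsAxialForm form) {v w z x y : A} (two_ne : (2 : F) ≠ 0)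
    (hvx : (2 : F) • (v * x) = form z x • v + form v x • z)
    (hwx : (2 : F) • (w * x) = form z x • w + form w x • z)
    (hvy : form v y = 0) (hwy : form w y = 0) (hzy : form z y = 0)
    (hzvy : (2 : F) • (z * (v * y)) = v * y) (hzwy : (2 : F) • (z * (w * y)) = w * y)
    (anti : v * (w * y) + w * (v * y) = 0) :
    fusionPart form x y v w + fusionPart form x y w v = 0 := by
  have e1 := congrArg (· * (w * y)) hvx
  have e2 := congrArg (· * (v * y)) hwx
  have e3 : 2 * form v (x * y) = 0 := by
    have := congrArg (fun t => form t y) hvx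
    simpa [hf.assoc v x y, hvy, hzy] using this
  have e4 : 2 * form w (x * y) = 0 := by
    have := congrArg (fun t => form t y) hwx
    simpa [hf.assoc w x y, hwy, hzy] using this
  simp only [add_mul, smul_mul_assoc] at e1 e2
  have e5 := (mul_eq_zero.1 e3).resolve_left two_ne
  have e6 := (mul_eq_zero.1 e4).resolve_left two_ne
  simp only [fusionPart_apply, e5, e6, hvy, hwy]
  linear_combination (norm := module) (2 : F) • e1 + (2 : F) • e2 + form v x • hzwy
    + form w x • hzvy + (2 * form z x) • anti

/-- Write `wy = 4v(v(wy))` and `vy = 4w(w(vy))`, so that `hv` and `hw` compute `(vx)(wy)` and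
`(wx)(vy)`. As `w(vy) = -v(wy)`, everything cancels in the sum except multiples of `v` and `w`,
which are matched by moving factors across the form. -/
theorem fusionPart_half (hf : IsAxialForm form) {v w z x y : A} (two_ne : (2 : F) ≠ 0)
    (hv : ∀ t, (2 : F) • (z * t) = t → (8 : F) • ((v * x) * (v * t)) =
      (2 * form v (x * t)) • v + (2 : F) • (x * t) + form x t • z - (4 : F) • (z * (x * t)))
    (hw : ∀ t, (2 : F) • (z * t) = t → (8 : F) • ((w * x) * (w * t)) =
      (2 * form w (x * t)) • w + (2 : F) • (x * t) + form x t • z - (4 : F) • (z * (x * t)))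
    (hvv : ∀ t, (2 : F) • (z * t) = t → (4 : F) • (v * (v * t)) = t)
    (hww : ∀ t, (2 : F) • (z * t) = t → (4 : F) • (w * (w * t)) = t)
    (hzv : ∀ t, (2 : F) • (z * t) = t → (2 : F) • (z * (v * t)) = v * t)
    (hzw : ∀ t, (2 : F) • (z * t) = t → (2 : F) • (z * (w * t)) = w * t)
    (hvy : form v y = 0) (hwy : form w y = 0) (hvx : form v x = 0) (hwx : form w x = 0)
    (hy : (2 : F) • (z * y) = y)
    (anti : v * (w * y) + w * (v * y) = 0) :
    fusionPart form x y v w + fusionPart form x y w v = 0 := by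
  have e1 := hv _ (hzv _ (hzw _ hy))
  have e2 := hw _ (hzw _ (hzv _ hy))
  have e3 := congrArg ((v * x) * ·) (hvv _ (hzw _ hy))
  have e4 := congrArg ((w * x) * ·) (hww _ (hzv _ hy))
  have e5 : w * (v * y) = -(v * (w * y)) := by linear_combination (norm := module) anti
  have e6 : 4 * form v (x * (v * (w * y))) = form w (x * y) := by
    have := congrArg (form x) (hvv _ (hzw _ hy))
    rw [map_smul, smul_eq_mul, hf.assoc x v, hf.assoc x w, mul_comm x v, mul_comm x w,
      ← hf.assoc w] at this
    rw [hf.assoc v, this]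
  have e7 : 4 * form w (x * (w * (v * y))) = form v (x * y) := by
    have := congrArg (form x) (hww _ (hzv _ hy))
    rw [map_smul, smul_eq_mul, hf.assoc x v, hf.assoc x w, mul_comm x v, mul_comm x w,
      ← hf.assoc v] at this
    rw [hf.assoc w, this]
  have e8 := congrArg (· • v) e6
  have e9 := congrArg (· • w) e7
  rw [e5] at e2 e4 e9
  simp only [mul_smul_comm, mul_neg, map_neg] at e2 e3 e4 e9
  refine smul_right_injective A two_ne ?_
  simp only [fusionPart_apply, hvx, hwx, hvy, hwy]
  linear_combination (norm := module) (4 : F) • e1 + (4 : F) • e2 - (8 : F) • e3 - (8 : F) • e4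
    + (2 : F) • e8 + (2 : F) • e9

namespace IsRightAngle

variable {a b z : A}

theorem symm (h : IsRightAngle form a b z) : IsRightAngle form b a z where
  left := h.right
  right := h.left
  mul := by rw [mul_comm, h.mul]; abel
  inner := by rw [h.left.form.comm, h.inner]

theorem fusionPart_diff (h : IsRightAngle form a b z) (two_ne : (2 : F) ≠ 0) (x y : A) :
    fusionPart form x y ((2 : F) • a - z) ((2 : F) • b - z)
      + fusionPart form x y ((2 : F) • b - z) ((2 : F) • a - z) = 0 := by
  have hf := h.left.form
  have hva : ∀ {a b : A}, IsRightAngle form a b z → z * ((2 : F) • a - z) = (2 : F) • a - z :=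
    fun h => by rw [mul_sub, mul_smul_comm, mul_comm z, h.left.mul, h.left.idem]
  have half : ∀ {a b : A}, IsRightAngle form a b z → ∀ t, (2 : F) • (z * t) = t →
      form ((2 : F) • a - z) t = 0 := fun h t ht => by
    rw [map_sub, map_smul, LinearMap.sub_apply, LinearMap.smul_apply, h.left.apply_eq_zero ht,
      h.left.apply_eq_zero' ht, smul_zero, sub_zero]
  have stable : ∀ {a b : A}, IsRightAngle form a b z → ∀ t, (2 : F) • (z * t) = t →
      (2 : F) • (z * (((2 : F) • a - z) * t)) = ((2 : F) • a - z) * t := fun h t ht => by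
    rw [← h.left.diff_mul_comm, ← mul_smul_comm, ht]
  have anti : ∀ t, (2 : F) • (z * t) = t → ((2 : F) • a - z) * (((2 : F) • b - z) * t)
      + ((2 : F) • b - z) * (((2 : F) • a - z) * t) = 0 := fun t ht => by
    refine smul_right_injective A two_ne ?_
    have := h.anticomm t
    rw [half h t ht, half h.symm t ht] at this
    linear_combination (norm := module) this
  have pure : ∀ {a b : A}, IsRightAngle form a b z → ∀ t,
      (2 : F) • (((2 : F) • a - z) * (t - ((4 : F) • (z * t) - (4 : F) • (z * (z * t))))) =
      form z (t - ((4 : F) • (z * t) - (4 : F) • (z * (z * t)))) • ((2 : F) • a - z)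
      + form ((2 : F) • a - z) (t - ((4 : F) • (z * t) - (4 : F) • (z * (z * t)))) • z :=
    fun h t => by
      rw [h.left.diff_mul_sub_halfPart, h.left.apply_self_sub_halfPart, map_sub, map_smul,
        LinearMap.sub_apply, LinearMap.sub_apply, LinearMap.smul_apply, LinearMap.smul_apply,
        h.left.apply_self_sub_halfPart, h.left.apply_sub_halfPart]
  have dec : ∀ t : A, ∃ m n : A, t = m + n ∧ (2 : F) • (z * m) = m ∧
      (2 : F) • (((2 : F) • a - z) * n) = form z n • ((2 : F) • a - z)
        + form ((2 : F) • a - z) n • z ∧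
      (2 : F) • (((2 : F) • b - z) * n) = form z n • ((2 : F) • b - z)
        + form ((2 : F) • b - z) n • z := fun t =>
    ⟨(4 : F) • (z * t) - (4 : F) • (z * (z * t)), _, (add_sub_cancel _ _).symm,
      h.left.mul_halfPart t, pure h t, pure h.symm t⟩
  obtain ⟨m, n, rfl, hm, hna, hnb⟩ := dec x
  obtain ⟨m', n', rfl, hm', hna', hnb'⟩ := dec y
  have mixed : ∀ m n : A, (2 : F) • (z * m) = m →
      (2 : F) • (((2 : F) • a - z) * n) = form z n • ((2 : F) • a - z)
        + form ((2 : F) • a - z) n • z →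
      (2 : F) • (((2 : F) • b - z) * n) = form z n • ((2 : F) • b - z)
        + form ((2 : F) • b - z) n • z →
      fusionPart form n m ((2 : F) • a - z) ((2 : F) • b - z)
        + fusionPart form n m ((2 : F) • b - z) ((2 : F) • a - z) = 0 := fun m n hm hna hnb =>
    fusionPart_mixed hf two_ne hna hnb (half h _ hm) (half h.symm _ hm)
      (h.left.apply_eq_zero' hm) (stable h _ hm) (stable h.symm _ hm) (anti _ hm)
  have mm := fusionPart_half hf two_ne (fun t ht => h.left.diff_mul_mul_diff_mul hm ht)
    (fun t ht => h.right.diff_mul_mul_diff_mul hm ht) (fun t => h.left.diff_mul_diff_mul)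
    (fun t => h.right.diff_mul_diff_mul) (stable h) (stable h.symm) (half h _ hm')
    (half h.symm _ hm') (half h _ hm) (half h.symm _ hm) hm' (anti _ hm')
  have nn := fusionPart_pure hf h.left.idem (hva h) (hva h.symm) h.diff_mul_diff two_ne hna hnb
    hna' hnb'
  have nm := mixed m' n hm' hna hnb
  have mn := mixed m n' hm hna' hnb'
  rw [fusionPart_swap] at mn
  simp only [fusionPart_add_left, fusionPart_add_right]
  linear_combination (norm := module) mm + nn + nm + mn

/-- A vector-valued quadratic function that vanishes on the axes, and whose polarisation vanishes
on the pair of differences, vanishes on the circle of idempotents. -/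
theorem quadratic_eq_zero (h : IsRightAngle form a b z) (two_ne : (2 : F) ≠ 0)
    (B : A →ₗ[F] A →ₗ[F] A) (L : A →ₗ[F] A) (hBL : ∀ e ∈ axes F A, B e e + L e = 0)
    (hB : B ((2 : F) • a - z) ((2 : F) • b - z) + B ((2 : F) • b - z) ((2 : F) • a - z) = 0)
    {x y : F} (hxy : x ^ 2 + y ^ 2 = 1) {c : A}
    (hc : (2 : F) • c = z + x • ((2 : F) • a - z) + y • ((2 : F) • b - z)) :
    B c c + L c = 0 := by
  -- The axes `a`, `z - a`, `b`, `z - b` are the points `(±1, 0)` and `(0, ±1)` of the circle. They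
  -- account for every coefficient but that of `xy`, which is `hB`.
  have ea := hBL _ h.left.left
  have ea' := hBL _ h.left.right
  have eb := hBL _ h.right.left
  have eb' := hBL _ h.right.right
  have e1 : (4 : F) • (B c c + L c) = B ((2 : F) • c) ((2 : F) • c) + (2 : F) • L ((2 : F) • c) := by
    simp only [map_smul, LinearMap.smul_apply]; module
  have k : (x ^ 2 + y ^ 2) • (B z z + (2 : F) • L z) = (1 : F) • (B z z + (2 : F) • L z) := by
    rw [hxy]
  rw [hc] at e1
  refine smul_right_injective A (mul_ne_zero two_ne two_ne) ?_
  simp only [map_add, map_sub, map_smul, LinearMap.add_apply, LinearMap.sub_apply,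
    LinearMap.smul_apply] at ea ea' eb eb' e1 hB
  linear_combination (norm := module) e1 + (2 * x + 2 * x ^ 2) • ea + (2 * x ^ 2 - 2 * x) • ea'
    + (2 * y + 2 * y ^ 2) • eb + (2 * y ^ 2 - 2 * y) • eb' + (x * y) • hB - k

end IsRightAngle

/-! ### Coordinates on `⟨⟨a, b⟩⟩` and its primitive idempotents -/

theorem two_smul_mul_eq (a b : A) : (2 : F) • (a * b) = center F a b + a + b := by
  rw [center]; abel

namespace IsAxialForm

variable {a b : A}

theorem right_apply_center (h : IsAxialForm form) (hb : b ∈ axes F A) :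
    form b (center F a b) = form a b - 1 := by
  rw [center_comm, h.apply_center hb, h.comm]

theorem center_apply_center (h : IsAxialForm form) (ha : a ∈ axes F A) (hb : b ∈ axes F A) :
    form (center F a b) (center F a b) = 2 * (form a b - 1) ^ 2 := by
  have h1 : form (center F a b) (center F a b) = 2 * form a (b * center F a b)
      - form a (center F a b) - form b (center F a b) := by
    conv_lhs => enter [1]; rw [center]
    simp only [map_sub, map_smul, LinearMap.sub_apply, LinearMap.smul_apply, smul_eq_mul, h.assoc]
  rw [h1, h.right_mul_center hb, h.apply_center ha, h.right_apply_center hb, map_smul, smul_eq_mul]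
  ring

theorem exists_of_mem_line (h : IsAxialForm form) (two_ne : (2 : F) ≠ 0) (ha : a ∈ axes F A)
    (hb : b ∈ axes F A) {c : A} (hc : c ∈ line F a b) :
    ∃ x y r : F, c = x • a + y • b + r • center F a b := by
  have hab : a * b = (1 / 2 : F) • (center F a b + a + b) := by
    rw [← two_smul_mul_eq, smul_smul, one_div, inv_mul_cancel₀ two_ne, one_smul]
  unfold line at hc
  induction hc using NonUnitalAlgebra.adjoin_induction with
  | mem c hc =>
    rcases hc with rfl | rfl
    · exact ⟨1, 0, 0, by module⟩
    · exact ⟨0, 1, 0, by module⟩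
  | zero => exact ⟨0, 0, 0, by module⟩
  | add u v _ _ hu hv =>
    obtain ⟨x, y, r, rfl⟩ := hu
    obtain ⟨x', y', r', rfl⟩ := hv
    exact ⟨x + x', y + y', r + r', by module⟩
  | smul t u _ hu =>
    obtain ⟨x, y, r, rfl⟩ := hu
    exact ⟨t * x, t * y, t * r, by module⟩
  | mul u v _ _ hu hv =>
    obtain ⟨x, y, r, rfl⟩ := hu
    obtain ⟨x', y', r', rfl⟩ := hv
    refine ⟨x * x' + (x * y' + y * x') * (1 / 2) + (form a b - 1) * (x * r' + r * x'),
      y * y' + (x * y' + y * x') * (1 / 2) + (form a b - 1) * (y * r' + r * y'),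
      (x * y' + y * x') * (1 / 2) + (form a b - 1) * (r * r'), ?_⟩
    simp only [mul_add, add_mul, smul_mul_assoc, mul_smul_comm, mul_comm b a,
      mul_comm (center F a b) a, mul_comm (center F a b) b, h.mul_center ha,
      h.right_mul_center hb, h.center_mul_center ha hb, (h.axis a ha).idem, (h.axis b hb).idem, hab]
    module

theorem sq_eq (h : IsAxialForm form) (ha : a ∈ axes F A) (hb : b ∈ axes F A) (x y r : F) :
    (x • a + y • b + r • center F a b) * (x • a + y • b + r • center F a b) =
      (x * (x + y + 2 * (form a b - 1) * r)) • a + (y * (x + y + 2 * (form a b - 1) * r)) • b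
        + (x * y + (form a b - 1) * r ^ 2) • center F a b := by
  simp only [mul_add, add_mul, smul_mul_assoc, mul_smul_comm, mul_comm b a,
    mul_comm (center F a b) a, mul_comm (center F a b) b, h.mul_center ha,
    h.right_mul_center hb, h.center_mul_center ha hb, (h.axis a ha).idem, (h.axis b hb).idem]
  linear_combination (norm := module) (x * y) • two_smul_mul_eq (F := F) a b

theorem eq_of_mul_eq_smul (h : IsAxialForm form) (ha : a ∈ axes F A) (hb : b ∈ axes F A)
    (hab : a * b = form a b • a) : a * b = 0 ∨ a = b := by
  have h1 := (h.axis b hb).sq a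
  rw [mul_comm b a, hab, mul_smul_comm, mul_comm b a, hab, h.comm b a] at h1
  rcases eq_or_ne (form a b) 0 with h0 | h0
  · left; rw [hab, h0, zero_smul]
  · right
    have h2 : b = (2 * form a b - 1) • a := by
      refine smul_right_injective A h0 ?_
      linear_combination (norm := module) -h1
    have h3 : form a b = 1 := by
      have := congrArg (form a) h2
      rw [map_smul, (h.axis a ha).norm, smul_eq_mul] at this
      linear_combination -this
    rw [h2, h3]; module

theorem center_self (h : IsAxialForm form) (ha : a ∈ axes F A) : center F a a = 0 := by
  rw [center, (h.axis a ha).idem]; module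

/-- Multiplying a relation by `a` and pairing it with `a` give the same coefficients, so their
difference is `y(ab - (a, b)a) = 0`; then `eq_of_mul_eq_smul` excludes `y ≠ 0`, and symmetrically `x
≠ 0`. -/
theorem coeff_eq_zero (h : IsAxialForm form) (ha : a ∈ axes F A) (hb : b ∈ axes F A)
    (hab : a * b ≠ 0) (hc : center F a b ≠ 0) {x y r : F}
    (h0 : x • a + y • b + r • center F a b = 0) : x = 0 ∧ y = 0 ∧ r = 0 := by
  have hne : a ≠ b := by rintro rfl; exact hc (h.center_self ha)
  have h1 := congrArg (a * ·) h0
  have h2 := congrArg (b * ·) h0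
  have h3 := congrArg (form a) h0
  have h4 := congrArg (form b) h0
  simp only [mul_add, mul_smul_comm, (h.axis a ha).idem, (h.axis b hb).idem, h.mul_center ha,
    h.right_mul_center hb, mul_comm b a, mul_zero, map_add, map_smul, map_zero, smul_eq_mul,
    (h.axis a ha).norm, (h.axis b hb).norm, h.apply_center ha, h.right_apply_center hb,
    h.comm b a] at h1 h2 h3 h4
  have hy : y = 0 := by
    by_contra hy
    rcases h.eq_of_mul_eq_smul ha hb (smul_right_injective A hy (by
      have := congrArg (· • a) h3
      beta_reduce at this
      linear_combination (norm := module) h1 - this)) with h | h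
    · exact hab h
    · exact hne h
  have hx : x = 0 := by
    by_contra hx
    rcases h.eq_of_mul_eq_smul hb ha (smul_right_injective A hx (by
      have := congrArg (· • b) h4
      beta_reduce at this
      rw [mul_comm b a, h.comm b a]
      linear_combination (norm := module) h2 - this)) with h | h
    · exact hab (mul_comm a b ▸ h)
    · exact hne h.symm
  subst hx hy
  refine ⟨rfl, rfl, ?_⟩
  rw [zero_smul, zero_smul, zero_add, zero_add] at h0
  exact (smul_eq_zero.1 h0).resolve_right hc

theorem left_mem_line (a b : A) : a ∈ line F a b := NonUnitalAlgebra.subset_adjoin F (by simp)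

theorem right_mem_line (a b : A) : b ∈ line F a b := NonUnitalAlgebra.subset_adjoin F (by simp)

theorem finrank_line (h : IsAxialForm form) (two_ne : (2 : F) ≠ 0) (ha : a ∈ axes F A)
    (hb : b ∈ axes F A) (hab : a * b ≠ 0) (hc : center F a b ≠ 0) :
    Module.finrank F (line F a b) = 3 := by
  have hli : LinearIndependent F ![a, b, center F a b] := by
    rw [Fintype.linearIndependent_iff]
    intro g hg
    rw [Fin.sum_univ_three] at hg
    obtain ⟨h0, h1, h2⟩ := h.coeff_eq_zero ha hb hab hc hg
    intro i
    fin_cases i <;> assumption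
  have hspan : (line F a b).toSubmodule = Submodule.span F (Set.range ![a, b, center F a b]) := by
    refine le_antisymm (fun c hc => ?_) (Submodule.span_le.2 ?_)
    · obtain ⟨x, y, r, rfl⟩ := h.exists_of_mem_line two_ne ha hb hc
      exact add_mem (add_mem (Submodule.smul_mem _ _ (Submodule.subset_span ⟨0, rfl⟩))
        (Submodule.smul_mem _ _ (Submodule.subset_span ⟨1, rfl⟩)))
        (Submodule.smul_mem _ _ (Submodule.subset_span ⟨2, rfl⟩))
    · have hl := left_mem_line (F := F) a b
      have hr := right_mem_line (F := F) a b
      rintro _ ⟨i, rfl⟩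
      fin_cases i
      · exact hl
      · exact hr
      · exact sub_mem (sub_mem ((line F a b).toSubmodule.smul_mem 2 ((line F a b).mul_mem hl hr)) hl) hr
  change Module.finrank F (line F a b).toSubmodule = 3
  rw [hspan, finrank_span_eq_card hli, Fintype.card_fin]

/-- As `(a, b) - 1 = -1/2`, the element `-2ρ` acts as the identity; `z - a` and `z - b` are the
images of `a` and `b` under each other's involutions. -/
theorem isRightAngle (h : IsAxialForm form) (ha : a ∈ axes F A)
    (hb : b ∈ axes F A) (hα : 2 * form a b = 1) :
    IsRightAngle form a b ((-2 : F) • center F a b) := by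
  have h0 : 4 * form a b - 2 = 0 := by linear_combination 2 * hα
  have h1 : -2 * (form a b - 1) = 1 := by linear_combination -hα
  refine ⟨⟨h, ha, ?_, ?_⟩, ⟨h, hb, ?_, ?_⟩, ?_, hα⟩
  · convert h.reflection_mem_axes' ha hb using 1
    rw [h0]; module
  · rw [mul_smul_comm, h.mul_center ha, smul_smul, h1, one_smul]
  · convert h.reflection_mem_axes ha hb using 1
    rw [h0]; module
  · rw [mul_smul_comm, h.right_mul_center hb, smul_smul, h1, one_smul]
  · rw [center]; module

/-- Points of the conic of idempotents of `⟨⟨a, b⟩⟩` are axes of the whole algebra. -/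
theorem peirceAxis_of_conic (h : IsAxialForm form) (two_ne : (2 : F) ≠ 0) (ha : a ∈ axes F A)
    (hb : b ∈ axes F A) (h4 : 4 * form a b - 1 ≠ 0) {x y r : F}
    (h1 : x + y + 2 * (form a b - 1) * r = 1)
    (hxy : x * y = r * (x + y + (form a b - 1) * r))
    (idem : (x • a + y • b + r • center F a b) * (x • a + y • b + r • center F a b) =
      x • a + y • b + r • center F a b) :
    PeirceAxis (x • a + y • b + r • center F a b) (form (x • a + y • b + r • center F a b)) := by
  have norm : form (x • a + y • b + r • center F a b) (x • a + y • b + r • center F a b) = 1 := by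
    simp only [map_add, map_smul, LinearMap.add_apply, LinearMap.smul_apply, smul_eq_mul,
      (h.axis a ha).norm, (h.axis b hb).norm, h.comm b a, h.comm (center F a b) a,
      h.comm (center F a b) b, h.apply_center ha, h.right_apply_center hb,
      h.center_apply_center ha hb]
    linear_combination (2 * (form a b - 1)) * hxy
      + (x + y + 2 * (form a b - 1) * r + 1) * h1
  rcases eq_or_ne (2 * form a b - 1) 0 with h2 | h2
  · have hα : 2 * form a b = 1 := by linear_combination h2
    have hr := h.isRightAngle ha hb hα
    have hr' : r = x + y - 1 := by linear_combination r * hα - h1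
    have hcirc : x ^ 2 + y ^ 2 = 1 := by
      subst hr'
      linear_combination -2 * hxy - (x + y - 1) ^ 2 * hα
    have hc : (2 : F) • (x • a + y • b + r • center F a b) = (-2 : F) • center F a b
        + x • ((2 : F) • a - (-2 : F) • center F a b)
        + y • ((2 : F) • b - (-2 : F) • center F a b) := by
      rw [hr']; module
    exact h.peirceAxis_of_quadratic idem norm
      (fun t => hr.quadratic_eq_zero two_ne _ _ (fun e he => h.sqPart_axis he t)
        (hr.sqPart_diff t) hcirc hc)
      (fun s t => hr.quadratic_eq_zero two_ne _ _ (fun e he => h.fusionPart_axis he s t)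
        (hr.fusionPart_diff two_ne s t) hcirc hc)
  · exact h.peirceAxis_of_quadratic idem norm
      (fun t => h.quadratic_eq_zero two_ne ha hb h4 h2 _ _ (fun e he => h.sqPart_axis he t) h1 hxy)
      (fun s t => h.quadratic_eq_zero two_ne ha hb h4 h2 _ _
        (fun e he => h.fusionPart_axis he s t) h1 hxy)

theorem peirceAxis_of_center_eq_zero (h : IsAxialForm form) (two_ne : (2 : F) ≠ 0)
    (ha : a ∈ axes F A) (hb : b ∈ axes F A) (hc : center F a b = 0) {x y : F} (h1 : x + y = 1)
    (idem : (x • a + y • b) * (x • a + y • b) = x • a + y • b) :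
    PeirceAxis (x • a + y • b) (form (x • a + y • b)) := by
  have hα : form a b = 1 := by
    have := h.apply_center ha (b := b)
    rw [hc, map_zero] at this
    linear_combination -this
  refine h.peirceAxis_of_quadratic idem ?_
    (fun t => h.quadratic_eq_zero_of_center_eq_zero two_ne ha hb hc _ _
      (fun e he => h.sqPart_axis he t) h1)
    (fun s t => h.quadratic_eq_zero_of_center_eq_zero two_ne ha hb hc _ _
      (fun e he => h.fusionPart_axis he s t) h1)
  simp only [map_add, map_smul, LinearMap.add_apply, LinearMap.smul_apply, smul_eq_mul,
    (h.axis a ha).norm, (h.axis b hb).norm, h.comm b a, hα]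
  linear_combination (x + y + 1) * h1

theorem isSolid_line (h : IsAxialForm form) (two_ne : (2 : F) ≠ 0) (ha : a ∈ axes F A)
    (hb : b ∈ axes F A) (hab : 4 * form a b - 1 ≠ 0 ∨ Module.finrank F (line F a b) ≠ 3) :
    IsSolid F (line F a b) := by
  rintro ⟨c, hcm⟩ hc
  have prim : ∀ d ∈ line F a b, c * d = d → ∃ k : F, d = k • c := by
    intro d hd hcd
    have hmem : (⟨d, hd⟩ : line F a b) ∈ adEigenspace F (⟨c, hcm⟩ : line F a b) 1 := by
      rw [mem_adEigenspace, one_smul]; exact Subtype.ext hcd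
    rw [hc.eigenspace_one] at hmem
    obtain ⟨k, hk⟩ := Submodule.mem_span_singleton.1 hmem
    exact ⟨k, (congrArg Subtype.val hk).symm⟩
  have idem : c * c = c := congrArg Subtype.val hc.idem
  have ne : c ≠ 0 := fun h0 => hc.ne_zero (Subtype.ext h0)
  clear hc
  change IsJordanAxis F (1 / 2 : F) c
  suffices ∃ φ, PeirceAxis c φ from this.elim fun φ hφ => hφ.isJordanAxis two_ne
  have hl := left_mem_line (F := F) a b
  have hr := right_mem_line (F := F) a b
  obtain ⟨x, y, r, rfl⟩ := h.exists_of_mem_line two_ne ha hb hcm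
  by_cases hm : a * b = 0
  · have hα : form a b = 0 := by rw [← (h.axis a ha).apply_mul, hm, map_zero]
    have hcen : center F a b = -a - b := by rw [center, hm]; module
    obtain ⟨s, hs⟩ : ∃ s, s = x - r := ⟨_, rfl⟩
    obtain ⟨t, ht⟩ : ∃ t, t = y - r := ⟨_, rfl⟩
    have hst : x • a + y • b + r • center F a b = s • a + t • b := by rw [hcen, hs, ht]; module
    rw [hst] at prim idem ne ⊢
    have hsq : (s • a + t • b) * (s • a + t • b) = s ^ 2 • a + t ^ 2 • b := by
      simp only [mul_add, add_mul, smul_mul_assoc, mul_smul_comm, (h.axis a ha).idem,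
        (h.axis b hb).idem, hm, mul_comm b a]
      module
    rw [hsq] at idem
    have hs2 := congrArg (form a) idem
    have ht2 := congrArg (form b) idem
    simp only [map_add, map_smul, smul_eq_mul, (h.axis a ha).norm, (h.axis b hb).norm,
      h.comm b a, hα] at hs2 ht2
    have hs3 : s * (s - 1) = 0 := by linear_combination hs2
    have ht3 : t * (t - 1) = 0 := by linear_combination ht2
    rcases mul_eq_zero.1 hs3 with hs0 | hs0 <;> rcases mul_eq_zero.1 ht3 with ht0 | ht0
    · exact absurd (by rw [hs0, ht0]; module) ne
    · refine ⟨form b, ?_⟩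
      convert h.axis b hb using 1
      rw [hs0, sub_eq_zero.1 ht0]; module
    · refine ⟨form a, ?_⟩
      convert h.axis a ha using 1
      rw [ht0, sub_eq_zero.1 hs0]; module
    -- The idempotent is `a + b`, which fixes both `a` and `b` and so is not primitive.
    · exfalso
      rw [sub_eq_zero] at hs0 ht0
      subst hs0 ht0
      obtain ⟨k, hk⟩ := prim a hl (by
        simp only [one_smul, add_mul, (h.axis a ha).idem, mul_comm b a, hm, add_zero])
      have k1 := congrArg (form a) hk
      have k2 := congrArg (form b) hk
      simp only [map_add, map_smul, smul_eq_mul, (h.axis a ha).norm, (h.axis b hb).norm,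
        h.comm b a, hα] at k1 k2
      exact one_ne_zero (α := F) (by linear_combination k1 - k2)
  by_cases hcen : center F a b = 0
  · have hα : form a b = 1 := by
      have := h.apply_center ha (b := b)
      rw [hcen, map_zero] at this
      linear_combination -this
    have hsq := h.sq_eq ha hb x y r
    rw [hcen, hα] at hsq
    rw [hcen, smul_zero, add_zero] at idem ne ⊢
    rw [smul_zero, add_zero] at hsq
    have h1 : x + y = 1 := by
      refine smul_left_injective F ne ?_
      beta_reduce
      rw [one_smul]
      conv_rhs => rw [← idem, hsq]
      module
    exact ⟨_, h.peirceAxis_of_center_eq_zero two_ne ha hb hcen h1 idem⟩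
  have h4 : 4 * form a b - 1 ≠ 0 :=
    hab.resolve_right fun h3 => h3 (h.finrank_line two_ne ha hb hm hcen)
  have hsq := (h.sq_eq ha hb x y r).symm.trans idem
  obtain ⟨e1, e2, e3⟩ := h.coeff_eq_zero ha hb hm hcen
    (x := x * (x + y + 2 * (form a b - 1) * r) - x)
    (y := y * (x + y + 2 * (form a b - 1) * r) - y) (r := x * y + (form a b - 1) * r ^ 2 - r)
    (by linear_combination (norm := module) hsq)
  rcases eq_or_ne (x + y + 2 * (form a b - 1) * r) 1 with h1 | h1
  · exact ⟨_, h.peirceAxis_of_conic two_ne ha hb h4 h1 (by linear_combination e3 - r * h1) idem⟩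
  -- Off the conic only the multiple of `ρ` that is the identity of `⟨⟨a, b⟩⟩` remains; it fixes
  -- `a`, which is not a multiple of it.
  · exfalso
    have hx : x = 0 := by
      refine (mul_eq_zero.1 (?_ : x * (x + y + 2 * (form a b - 1) * r - 1) = 0)).resolve_right
        (sub_ne_zero.2 h1)
      linear_combination e1
    have hy : y = 0 := by
      refine (mul_eq_zero.1 (?_ : y * (x + y + 2 * (form a b - 1) * r - 1) = 0)).resolve_right
        (sub_ne_zero.2 h1)
      linear_combination e2
    subst hx hy
    have hr0 : r ≠ 0 := by rintro rfl; exact ne (by module)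
    have hr1 : r * (form a b - 1) = 1 := by
      refine mul_left_cancel₀ hr0 ?_
      linear_combination e3
    obtain ⟨k, hk⟩ := prim a hl (by
      rw [zero_smul, zero_smul, zero_add, zero_add, smul_mul_assoc, mul_comm, h.mul_center ha,
        smul_smul, hr1, one_smul])
    exact one_ne_zero (h.coeff_eq_zero ha hb hm hcen (x := 1) (y := 0) (r := -(k * r))
      (by linear_combination (norm := module) hk)).1

end IsAxialForm

end AxialJordan

theorem theorem1p1 {F : Type*} [Field F] (hF : ringChar F ≠ 2)
    {A : Type*} [NonUnitalNonAssocCommRing A] [Module F A] [SMulCommClass F A A]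
    [IsScalarTower F A A] (X : Set A)
    (hX : AxialJordan.IsPrimitiveAxialAlgebra F (1 / 2 : F) X) :
    ∃ form : LinearMap.BilinForm F A,
      AxialJordan.IsFrobeniusForm F X form ∧
      (∀ form' : LinearMap.BilinForm F A,
        AxialJordan.IsFrobeniusForm F X form' → form' = form) ∧
      ∀ a ∈ X, ∀ b ∈ X,
        (form a b ≠ 1 / 4 ∨ Module.finrank F (AxialJordan.line F a b) ≠ 3) →
          AxialJordan.IsSolid F (AxialJordan.line F a b) := by
  have two_ne : (2 : F) ≠ 0 := Ring.two_ne_zero hF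
  have four_ne : (4 : F) ≠ 0 := by
    have : (4 : F) = 2 * 2 := by norm_num
    rw [this]; exact mul_ne_zero two_ne two_ne
  have hsub : X ⊆ AxialJordan.axes F A := fun a ha =>
    (hX.axis a ha).exists_peirceAxis two_ne (hX.primitive a ha)
  obtain ⟨form, h⟩ :=
    AxialJordan.exists_isAxialForm two_ne (AxialJordan.span_axes two_ne hsub hX.generates)
  have hfrob : AxialJordan.IsFrobeniusForm F X form :=
    ⟨h.assoc, fun a ha => (h.axis a (hsub ha)).norm⟩
  refine ⟨form, hfrob, fun form' h' => h'.eq_of_isFrobeniusForm hsub hX.generates hfrob,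
    fun a ha b hb hab => h.isSolid_line two_ne (hsub ha) (hsub hb) (hab.imp_left fun hne h0 => ?_)⟩
  rw [Ne, eq_div_iff four_ne] at hne
  exact hne (by linear_combination h0)
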